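/- All cardinals are infinite, and a cardinal is identified with its initial ordinal. For cardinals $\theta\le\mu$ let $[\mu]^\theta$ be the set of subsets of $\mu$ of cardinality $\theta$, let $\overline{[\mu]^\theta}=\{X\in[\mu]^\theta : |X\cap\alpha|<\theta \text{ for all } \alpha<\mu\}$, and let $\underline{[\mu]^\theta}=\bigcup_{\alpha<\mu}[\alpha]^\theta$ be the set of those $X\in[\mu]^\theta$ that are bounded in $\mu$. For a partially ordered set $P$, a set $D\subseteq P$ is dense if every element of $P$ is above some element of $D$; $\mathcal D(P)$ is the least cardinality of a dense subset of $P$; and $\mathcal A\subseteq P$ is an antichain if no two distinct elements of $\mathcal A$ have a common lower bound in $P$. Write $\underline{\mathcal D(\mu,\theta)}=\mathcal D(\underline{[\mu]^\theta},\subseteq)$ (the lower $\theta$-density of $\mu$). For regular $\kappa<\theta$ let $S^\theta_\kappa=\{i<\theta:\operatorname{cf} i=\kappa\}$ and let $\mathcal S^\theta_\kappa$ be the family of all subsets of $S^\theta_\kappa$ that are stationary in $\theta$. For a cardinal $\lambda=\aleph_\alpha$ and an ordinal $\gamma$ let $\lambda^{+\gamma}=\aleph_{\alpha+\gamma}$.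 **Theorem.** Suppose $\kappa=\operatorname{cf}\kappa<\theta=\operatorname{cf}\mu<\mu$ and $\langle\kappa_i:i<\theta\rangle$ is a strictly increasing and continuous sequence of cardinals with limit $\mu$ and $\theta<\kappa_0$. Let $\mathcal A\subseteq\overline{[\mu]^\theta}$ be an antichain in $\langle\overline{[\mu]^\theta},\subseteq\rangle$ and let $\gamma<\theta$ be an ordinal. Suppose that there is a sequence $\langle\mathcal D_i:i\in S^\theta_\kappa\rangle$ such that 1. $\mathcal D_i\subseteq\overline{[\kappa_i]^\kappa}$ and $|\mathcal D_i|\le\kappa_i^{+\gamma}$ for all $i\in S^\theta_\kappa$; 2. for every $A\in\mathcal A$ the set $\{i\in S^\theta_\kappa:(\exists X\in\mathcal D_i)\,X\subseteq A\}$ is stationary in $\theta$. Then $$|\mathcal A|\le\mu^{+\gamma}+\underline{\mathcal D(\mu,\theta)}+\mathcal D(\mathcal S^\theta_\kappa,\subseteq).$$ -/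

import Mathlib

universe u

open Cardinal Ordinal Set

noncomputable section

namespace DensityArithmetic

/-- `A` is dense in `B`: every member of `B` lies above some member of `A`. -/
def IsDenseIn {P : Type u} [PartialOrder P] (A B : Set P) : Prop :=
  ∀ y ∈ B, ∃ x ∈ A, x ≤ y

/-- The density of the suborder `B` of `P`: the least cardinality of a subset of `B` that is
dense in `B`. -/
def density {P : Type u} [PartialOrder P] (B : Set P) : Cardinal.{u} :=
  sInf {c | ∃ A : Set P, A ⊆ B ∧ IsDenseIn A B ∧ #A = c}

/-- `A` is an antichain in the suborder `B` of `P`: two distinct members of `A` have no common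
lower bound in `B` (strong antichain, i.e. pairwise incompatible elements). -/
def IsAntichainIn {P : Type u} [PartialOrder P] (A B : Set P) : Prop :=
  A ⊆ B ∧ ∀ x ∈ A, ∀ y ∈ A, x ≠ y → ¬ ∃ z ∈ B, z ≤ x ∧ z ≤ y

/-- `[μ]^θ`: the subsets of `μ` (identified with the set of ordinals below its initial ordinal)
of cardinality `θ`. The lift is only a change of universe. -/
def subsetsOfCard (μ θ : Cardinal.{u}) : Set (Set Ordinal.{u}) :=
  {X | X ⊆ Iio μ.ord ∧ #X = lift.{u + 1} θ}

/-- The upper part of `[μ]^θ`: those `X` in `[μ]^θ` with `|X ∩ α| < θ` for all `α < μ`. -/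
def upperSubsets (μ θ : Cardinal.{u}) : Set (Set Ordinal.{u}) :=
  {X | X ∈ subsetsOfCard μ θ ∧ ∀ α < μ.ord, #(X ∩ Iio α : Set Ordinal.{u}) < lift.{u + 1} θ}

/-- The lower part of `[μ]^θ`: those `X` in `[μ]^θ` that are subsets of some `α < μ`. -/
def lowerSubsets (μ θ : Cardinal.{u}) : Set (Set Ordinal.{u}) :=
  {X | X ∈ subsetsOfCard μ θ ∧ ∃ α < μ.ord, X ⊆ Iio α}

/-- The lower `θ`-density of `μ`. -/
def lowerDensity (μ θ : Cardinal.{u}) : Cardinal.{u + 1} :=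
  density (lowerSubsets μ θ)

/-- `S^θ_κ`: the ordinals below `θ` of cofinality `κ`. -/
def cofSet (θ κ : Cardinal.{u}) : Set (Iio θ.ord) :=
  {i | (i : Ordinal.{u}).cof = κ}

/-- The family of all stationary subsets of `S^θ_κ` (stationary in `θ`). -/
def stationarySubsets (θ κ : Cardinal.{u}) : Set (Set (Iio θ.ord)) :=
  {S | S ⊆ cofSet θ κ ∧ IsStationary S}

/-- `c^{+γ}`: the `γ`-th cardinal successor of `c`; for `c = ℵ_ α` this is `ℵ_ (α + γ)`. -/
def succIter (c : Cardinal.{u}) (γ : Ordinal.{u}) : Cardinal.{u} :=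
  preAleph (preAleph.symm c + γ)

end DensityArithmetic

end

/-! The antichain is cut into few pieces, each compared with a simpler family `D`. Each `X` in it
selects some `Y ∈ D i` with `Y ⊆ X` for stationarily many `i`; once `D i` is enumerated in type `(k
i)^{+γ}`, this gives a function `p` in the product of these cardinals. A stationary `S` from a dense
family of stationary sets lies inside the set of such `i`, and by `hasSmallDomination` one of at
most `μ^{+γ}` small functions `g` dominates `p` on a stationary subset of `S`. Sorting by the pair
`(S, g)` leaves pieces for which `D i` may be replaced by an initial segment, of size at most `(k
i)^{+b}` for a fixed `b < γ`, or at most a fixed `k j`. The first case is an induction on the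
exponent (`mk_le_of_mk_le_succIter`). In the second (`mk_le_lowerDensity`) the selections are coded
as bounded subsets of `μ` of size `θ`, and a common subset of size `θ` of two codes forces the two
members of the antichain to be equal.

`hasSmallDomination` is itself an induction: Fodor at zero, a union of fewer than `θ` sets at
limits. If it failed at `b + 1`, all families of `μ^{+(b+1)}` functions would be bounded modulo the
club filter on some stationary set. Club guessing then yields an increasing sequence `f` of length
`μ^{+(b+1)}` with many pointwise monotone chains, and a bound `h` of `f`. The sets of ordinals below
`h i`, of size at most `(k i)^{+b}`, interleave with `f`; domination at lower exponents shrinks them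
repeatedly until their size is at most a fixed `k j`, too small to interleave with a chain of length
`(k j)^+`. -/

namespace DensityArithmetic

/-! ### Clubs, Fodor's lemma and chains in regular well-orders. -/

section WellOrder

variable {α : Type u} [LinearOrder α] [WellFoundedLT α]

theorem exists_isLUB_of_bddAbove {s : Set α} (hs : BddAbove s) : ∃ x, IsLUB s x :=
  ⟨wellFounded_lt.min _ hs, wellFounded_lt.min_mem _ hs,
    fun _ hy => not_lt.1 (wellFounded_lt.not_lt_min _ hy)⟩

theorem isRegularCardinalOrder_Iio {c : Cardinal.{u}} (hc : c.IsRegular) :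
    IsRegularCardinalOrder (Iio c.ord) where
  type_lt_le_ord_cof := by
    rw [Ordinal.cof_Iio, ← Ordinal.lift_cof, hc.cof_ord]
    simp

theorem isRegularCardinalOrder_toType {c : Cardinal.{u}} (hc : c.IsRegular) :
    IsRegularCardinalOrder c.ord.ToType where
  type_lt_le_ord_cof := by
    rw [Ordinal.cof_toType, hc.cof_ord, type_toType]

theorem mk_Iio_ord_card (c : Cardinal.{u}) : #(Iio c.ord) = lift.{u + 1} c := by
  rw [Cardinal.mk_Iio_ordinal, card_ord]

variable [IsRegularCardinalOrder α]

theorem mk_Iio_lt_of_regular (x : α) : #(Iio x) < #α := by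
  have h : typein (α := α) (· < ·) x < ord #α := by
    rw [Cardinal.ord_cardinalMk]; exact typein_lt_type _ x
  exact Cardinal.lt_ord.1 h

theorem exists_gt_of_mk_lt {s : Set α} (hs : #s < #α) : ∃ y, ∀ x ∈ s, x < y := by
  rw [← Order.cof_eq_cardinalMk (α := α)] at hs
  have : ¬ IsCofinal s := fun h => (Order.cof_le h).not_gt hs
  rw [not_isCofinal_iff] at this
  exact this

theorem exists_succ_of_regular (h0 : ℵ₀ ≤ #α) (a : α) : ∃ b, a < b ∧ ∀ x, a < x → b ≤ x := by
  obtain ⟨y, hy⟩ := exists_gt_of_mk_lt (s := {a}) (by simpa using one_lt_aleph0.trans_le h0)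
  obtain ⟨b, hb, hb'⟩ := wellFounded_lt.has_min (Ioi a) ⟨y, hy a rfl⟩
  exact ⟨b, hb, fun x hx => not_lt.1 (hb' x hx)⟩

theorem exists_gt_range_of_mk_lt {ι : Type u} (f : ι → α) (hι : #ι < #α) :
    ∃ y, ∀ i, f i < y := by
  obtain ⟨y, hy⟩ := exists_gt_of_mk_lt (s := range f) (mk_range_le.trans_lt hι)
  exact ⟨y, fun i => hy _ ⟨i, rfl⟩⟩

/-- The closure points of a function on an uncountable regular order form a club. -/
theorem isClub_closurePoints (h0 : ℵ₀ < #α) (h : α → α) : IsClub {d | ∀ x < d, h x < d} := by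
  refine ⟨fun s hs hne _ a ha x hx => ?_, fun a => ?_⟩
  · obtain ⟨b, hb, hxb⟩ := (lt_isLUB_iff ha).1 hx
    exact (hs hb x hxb).trans_le (ha.1 hb)
  · have H : ∀ x : α, ∃ y, x < y ∧ ∀ z < x, h z < y := by
      intro x
      have hlt : #(Option (Iio x)) < #α := by
        rw [mk_option]
        exact add_lt_of_lt h0.le (mk_Iio_lt_of_regular x) (one_lt_aleph0.trans h0)
      obtain ⟨y, hy⟩ := exists_gt_range_of_mk_lt
        (fun o : Option (Iio x) => o.elim x (fun z => h z)) hlt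
      exact ⟨y, hy none, fun z hz => hy (some ⟨z, hz⟩)⟩
    choose n hn1 hn2 using H
    obtain ⟨b, hb⟩ := exists_gt_of_mk_lt (s := range fun m : ℕ => n^[m] a)
      (((le_aleph0_iff_set_countable.2 (countable_range _))).trans_lt h0)
    obtain ⟨d, hd⟩ := exists_isLUB_of_bddAbove (s := range fun m : ℕ => n^[m] a)
      ⟨b, fun x hx => (hb x hx).le⟩
    refine ⟨d, fun x hx => ?_, hd.1 ⟨0, rfl⟩⟩
    obtain ⟨_, ⟨m, rfl⟩, hm⟩ := (lt_isLUB_iff hd).1 hx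
    refine (hn2 _ x hm).trans_le (hd.1 ⟨m + 1, ?_⟩)
    simp [Function.iterate_succ_apply']

theorem cof_ne_aleph0_of_regular (h0 : ℵ₀ < #α) : Order.cof α ≠ ℵ₀ := by
  rw [Order.cof_eq_cardinalMk]; exact h0.ne'

theorem isClub_Ioi (h0 : ℵ₀ < #α) (a : α) : IsClub (Ioi a) := by
  refine ⟨fun s hs hne _ b hb => ?_, fun b => ?_⟩
  · obtain ⟨x, hx⟩ := hne
    exact (hs hx).trans_le (hb.1 hx)
  · obtain ⟨y, hy⟩ := exists_gt_of_mk_lt (s := {a, b})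
      ((mk_lt_aleph0_iff.2 inferInstance).trans h0)
    exact ⟨y, hy a (by simp), (hy b (by simp)).le⟩

/-- Fodor's pressing down lemma. -/
theorem exists_isStationary_fiber {S : Set α} (h0 : ℵ₀ < #α) (hS : IsStationary S) (r : α → α)
    (hr : ∀ i ∈ S, r i < i) : ∃ j, IsStationary {i ∈ S | r i = j} := by
  by_contra! H
  simp_rw [not_isStationary_iff] at H
  choose C hC hdis using H
  have hnext : ∀ x : α, ∃ y, ∀ j ≤ x, ∃ c ∈ C j, x < c ∧ c < y := by
    intro x
    have hc : ∀ j, ∃ c ∈ C j, x < c := by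
      intro j
      obtain ⟨c, hc, h⟩ := ((hC j).inter (cof_ne_aleph0_of_regular h0)
        (isClub_Ioi h0 x)).isCofinal x
      exact ⟨c, hc.1, hc.2⟩
    choose c hc1 hc2 using hc
    have hlt : #(Iic x) < #α := by
      have : Iic x = insert x (Iio x) := by ext; simp [le_iff_eq_or_lt]
      rw [this]
      exact (mk_insert_le).trans_lt (add_lt_of_lt h0.le (mk_Iio_lt_of_regular x)
        (one_lt_aleph0.trans h0))
    obtain ⟨y, hy⟩ := exists_gt_range_of_mk_lt (fun j : Iic x => c j) hlt
    exact ⟨y, fun j hj => ⟨c j, hc1 j, hc2 j, hy ⟨j, hj⟩⟩⟩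
  choose h hh using hnext
  -- Below a closure point `i` of `h` every `C j` with `j < i` is unbounded, so `i ∈ C j`; this
  -- applies to `j = r i`.
  obtain ⟨i, hiS, hi⟩ := hS (isClub_closurePoints h0 h)
  have hmem : i ∈ C (r i) := by
    refine (hC (r i)).isLUB_mem (t := C (r i) ∩ Iio i) inter_subset_left ?_ ⟨fun x hx => hx.2.le, ?_⟩
    · obtain ⟨c, hc, h1, h2⟩ := hh (r i) (r i) le_rfl
      exact ⟨c, hc, h2.trans (hi _ (hr i hiS))⟩
    · intro b hb
      by_contra! hbi
      obtain ⟨c, hc, h1, h2⟩ := hh (max b (r i)) (r i) (le_max_right _ _)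
      have hmax : max b (r i) < i := max_lt hbi (hr i hiS)
      exact (((le_max_left _ _).trans_lt h1).trans_le (hb ⟨hc, h2.trans (hi _ hmax)⟩)).false
  exact Set.disjoint_left.1 (hdis (r i)) ⟨hiS, rfl⟩ hmem

/-- A regular order has the order type of an initial ordinal, so comparing cardinalities already
compares order types. -/
theorem exists_strictMono_of_mk_le {β : Type u} [LinearOrder β] [WellFoundedLT β] {s : Set β}
    (h : #α ≤ #s) : ∃ c : α → β, StrictMono c ∧ ∀ a, c a ∈ s := by
  have h1 : typeLT α ≤ typeLT s := by
    rw [← Cardinal.ord_cardinalMk, ord_le, card_type]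
    exact h
  obtain ⟨e⟩ := type_le_iff'.1 h1
  exact ⟨fun a => (e a : β), fun a b hab => e.map_rel_iff.2 hab, fun a => (e a).2⟩

end WellOrder

/-! ### The club filter and stationarity as frequency. -/

section ClubFilter

open Filter

variable {α : Type u} [LinearOrder α]

/-- The filter generated by the club sets. -/
def clubFilter (α : Type u) [LinearOrder α] : Filter α :=
  ⨅ C ∈ {C : Set α | IsClub C}, 𝓟 C

theorem mem_clubFilter_of_isClub {C : Set α} (hC : IsClub C) : C ∈ clubFilter α :=
  mem_iInf_of_mem C (mem_iInf_of_mem hC (mem_principal_self C))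

variable [WellFoundedLT α]

theorem mem_clubFilter_iff (h0 : Order.cof α ≠ ℵ₀) {s : Set α} :
    s ∈ clubFilter α ↔ ∃ C, IsClub C ∧ C ⊆ s := by
  rw [clubFilter, mem_biInf_of_directed]
  · simp
  · intro C hC D hD
    exact ⟨C ∩ D, hC.inter h0 hD, by simp, by simp⟩
  · exact ⟨univ, .univ⟩

theorem frequently_clubFilter_iff (h0 : Order.cof α ≠ ℵ₀) {p : α → Prop} :
    (∃ᶠ i in clubFilter α, p i) ↔ IsStationary {i | p i} := by
  rw [← not_iff_not, not_frequently, not_isStationary_iff, Filter.Eventually,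
    mem_clubFilter_iff h0]
  refine exists_congr fun C => and_congr_right fun _ => ?_
  rw [disjoint_comm, Set.disjoint_left]
  rfl

theorem frequently_clubFilter_inf_iff (h0 : Order.cof α ≠ ℵ₀) {S : Set α} {p : α → Prop} :
    (∃ᶠ i in clubFilter α ⊓ 𝓟 S, p i) ↔ IsStationary {i ∈ S | p i} := by
  rw [frequently_inf_principal, frequently_clubFilter_iff h0]

theorem clubFilter_inf_neBot_iff (h0 : Order.cof α ≠ ℵ₀) {S : Set α} :
    (clubFilter α ⊓ 𝓟 S).NeBot ↔ IsStationary S := by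
  rw [← frequently_true_iff_neBot, frequently_clubFilter_inf_iff h0]
  simp

end ClubFilter

/-! ### Club guessing. -/

section ClubGuessing

variable {Λ T : Type u} [LinearOrder Λ] [WellFoundedLT Λ]

/-- The largest element of `E` that is at most `b` (junk value `b` if there is none). -/
noncomputable def floorIn (E : Set Λ) (b : Λ) : Λ :=
  open Classical in if h : ∃ x, IsGreatest (E ∩ Iic b) x then h.choose else b

theorem floorIn_isGreatest {E : Set Λ} (hE : DirSupClosed E) {a b : Λ} (ha : a ∈ E) (hab : a ≤ b) :
    IsGreatest (E ∩ Iic b) (floorIn E b) := by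
  have h : ∃ x, IsGreatest (E ∩ Iic b) x := by
    obtain ⟨x, hx⟩ := exists_isLUB_of_bddAbove (s := E ∩ Iic b) ⟨b, fun y hy => hy.2⟩
    exact ⟨x, ⟨hE inter_subset_left ⟨a, ha, hab⟩ (.of_linearOrder _) hx, hx.2 fun y hy => hy.2⟩,
      hx.1⟩
  rw [floorIn, dif_pos h]
  exact h.choose_spec

variable [IsRegularCardinalOrder Λ] [LinearOrder T] [WellFoundedLT T] [IsRegularCardinalOrder T]

/-- Club guessing: if the successor of `#T` is smaller than `#Λ`, some family of `#Λ` many sets of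
size at most `#T` has members of size `#T` inside every club. -/
theorem exists_club_guessing (hT : ℵ₀ ≤ #T) (hΛ : Order.succ #T < #Λ) :
    ∃ C : Λ → Set Λ, (∀ d, #(C d) ≤ #T) ∧ ∀ E, IsClub E → ∃ d, C d ⊆ E ∧ #T ≤ #(C d) := by
  have hTΛ : #T < #Λ := (Order.lt_succ _).trans hΛ
  have h0 : ℵ₀ < #Λ := hT.trans_lt hTΛ
  have : Nonempty Λ := mk_ne_zero_iff.1 (aleph0_pos.trans h0).ne'
  let bot : Λ := wellFounded_lt.min univ univ_nonempty
  have hbot : ∀ x, bot ≤ x := fun x => not_lt.1 (wellFounded_lt.not_lt_min _ (mem_univ x))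
  have hA : ∀ d : Λ, ∃ A : Set Λ, #A ≤ #T ∧ ∀ c : T → Λ, StrictMono c → IsLUB (range c) d →
      A ⊆ Iio d ∧ ∀ x < d, ∃ a ∈ A, x < a := by
    intro d
    by_cases h : ∃ c : T → Λ, StrictMono c ∧ IsLUB (range c) d
    · obtain ⟨c, hc, hd⟩ := h
      refine ⟨range c, mk_range_le, fun _ _ _ => ⟨?_, fun x hx => (lt_isLUB_iff hd).1 hx⟩⟩
      rintro _ ⟨t, rfl⟩
      obtain ⟨t', ht, -⟩ := exists_succ_of_regular hT t
      exact (hc ht).trans_le (hd.1 ⟨t', rfl⟩)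
    · exact ⟨∅, by simp, fun c hc hd => absurd ⟨c, hc, hd⟩ h⟩
  choose A hAcard hA using hA
  -- The guess at `d` is the cofinal set `A d` rounded down into `E`. If it fails for every `E`, a
  -- club `N E` witnesses the failure.
  let G : Set Λ → Λ → Set Λ := fun E d => floorIn E '' A d \ {bot}
  by_contra! H
  have H' : ∀ E : Set Λ, ∃ E', IsClub E' ∧ ∀ d, G E d ⊆ E' → #(G E d) < #T := fun E =>
    H (G E) fun d => (mk_le_mk_of_subset sdiff_subset).trans (mk_image_le.trans (hAcard d))
  choose N hNclub hN using H'
  let U := (Order.succ #T).ord.ToType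
  have hUreg : IsRegularCardinalOrder U := isRegularCardinalOrder_toType (isRegular_succ hT)
  have hU : #U = Order.succ #T := by simp [U]
  have hTU : #T < #U := hU ▸ Order.lt_succ _
  -- A decreasing sequence of clubs of length `(#T)^+`, each inside the failure witnesses of all
  -- earlier ones. Adjoining `bot` makes every floor exist; `G` removes it again.
  obtain ⟨E, hE⟩ : ∃ E : U → Set Λ, ∀ a, E a = ⋂ b : Iio a, insert bot (N (E b)) := by
    let step : (a : U) → ((b : U) → b < a → Set Λ) → Set Λ :=
      fun a F => ⋂ b : Iio a, insert bot (N (F b b.2))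
    exact ⟨(wellFounded_lt (α := U)).fix step, fun a => (wellFounded_lt (α := U)).fix_eq step a⟩
  have hNclub' : ∀ X, IsClub (insert bot (N X)) := fun X =>
    ⟨(DirSupClosed.union (fun s hs hne _ x hx => by
      obtain ⟨y, hy⟩ := hne
      have h1 : s = {bot} := Subset.antisymm hs (by rw [← hs hy]; simpa using hy)
      rw [h1] at hx
      exact hx.unique isLUB_singleton) (hNclub X).dirSupClosed),
      (hNclub X).isCofinal.mono (subset_insert _ _)⟩
  have hcof : Order.cof Λ ≠ ℵ₀ := cof_ne_aleph0_of_regular h0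
  have hEclub : ∀ a, IsClub (E a) := by
    intro a
    rw [hE]
    refine IsClub.iInter hcof ?_ fun b => hNclub' _
    rw [Order.cof_eq_cardinalMk, Cardinal.lift_lt, ]
    exact (mk_Iio_lt_of_regular a).trans (hU ▸ hΛ)
  have hEbot : ∀ a, bot ∈ E a := fun a => by rw [hE]; simp
  have hEN : ∀ a b, a < b → E b ⊆ insert bot (N (E a)) := fun a b hab => by
    rw [hE b]; exact iInter_subset (fun b : Iio b => insert bot (N (E b))) ⟨a, hab⟩
  have hEanti : ∀ a b, a ≤ b → E b ⊆ E a := by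
    intro a b hab
    rw [hE a, hE b]
    exact subset_iInter fun c =>
      iInter_subset (fun b : Iio b => insert bot (N (E b))) ⟨c, c.2.trans_le hab⟩
  have hlim : IsClub (⋂ a, E a) := by
    refine IsClub.iInter hcof ?_ hEclub
    rw [Order.cof_eq_cardinalMk, Cardinal.lift_lt, hU]
    exact hΛ
  obtain ⟨c, hc, hcE⟩ := exists_strictMono_of_mk_le (α := T) (s := ⋂ a, E a)
    (hTΛ.le.trans (Order.cof_eq_cardinalMk (α := Λ) ▸ Order.cof_le hlim.isCofinal))
  obtain ⟨y, hy⟩ := exists_gt_range_of_mk_lt c hTΛ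
  obtain ⟨d, hd⟩ := exists_isLUB_of_bddAbove (s := range c) ⟨y, by rintro _ ⟨t, rfl⟩; exact (hy t).le⟩
  obtain ⟨hAd, hAd'⟩ := hA d c hc hd
  have hfl : ∀ a b, IsGreatest (E a ∩ Iic b) (floorIn (E a) b) := fun a b =>
    floorIn_isGreatest (hEclub a).dirSupClosed (hEbot a) (hbot b)
  -- Floors decrease as the club shrinks, so each is eventually constant. As `A d` has at most `#T`
  -- elements, one stage serves them all.
  have hstab : ∀ b : Λ, ∃ a : U, ∀ a' ≥ a, floorIn (E a') b = floorIn (E a) b := by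
    intro b
    have : Nonempty U := mk_ne_zero_iff.1 (by rw [hU]; exact (Cardinal.succ_pos _).ne')
    obtain ⟨_, ⟨a, rfl⟩, ha⟩ := wellFounded_lt.has_min (range fun a => floorIn (E a) b)
      (range_nonempty _)
    refine ⟨a, fun a' haa' => le_antisymm ?_ (not_lt.1 (ha _ ⟨a', rfl⟩))⟩
    exact (hfl a b).2 ⟨hEanti _ _ haa' (hfl a' b).1.1, (hfl a' b).1.2⟩
  choose st hst using hstab
  obtain ⟨a, ha⟩ := exists_gt_range_of_mk_lt (α := U) (fun b : A d => st b)
    ((hAcard d).trans_lt hTU)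
  obtain ⟨a', ha'⟩ : ∃ a', a < a' := by
    obtain ⟨y, hy, -⟩ := exists_succ_of_regular (hT.trans hTU.le) a
    exact ⟨y, hy⟩
  have hsub : G (E a) d ⊆ N (E a) := by
    rintro _ ⟨⟨b, hb, rfl⟩, hne⟩
    have h1 : floorIn (E a') b = floorIn (E a) b :=
      (hst b a' ((ha ⟨b, hb⟩).trans ha').le).trans (hst b a (ha ⟨b, hb⟩).le).symm
    exact (hEN a a' ha' (h1 ▸ (hfl a' b).1.1)).resolve_left hne
  -- Rounding down keeps the guess cofinal in `d`, since `d` is the limit of the points `c t` of `E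
  -- a`; so it has at least `#T` elements.
  refine (hN (E a) d hsub).not_ge ?_
  have hcofinal : ∀ t, ∃ g ∈ G (E a) d, c t ≤ g := by
    intro t
    obtain ⟨t', ht', -⟩ := exists_succ_of_regular hT t
    have ht := hc ht'
    obtain ⟨t'', ht'', -⟩ := exists_succ_of_regular hT t'
    obtain ⟨b, hb, hlt⟩ := hAd' (c t') ((hc ht'').trans_le (hd.1 ⟨_, rfl⟩))
    have hle : c t' ≤ floorIn (E a) b := (hfl a b).2 ⟨mem_iInter.1 (hcE t') a, hlt.le⟩
    exact ⟨_, ⟨⟨b, hb, rfl⟩, ((hbot _).trans_lt (ht.trans_le hle)).ne'⟩, ht.le.trans hle⟩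
  by_contra! hlt
  have hG : ∀ g : G (E a) d, ∃ t, (g : Λ) < c t := by
    rintro ⟨_, ⟨b, hb, rfl⟩, -⟩
    obtain ⟨_, ⟨t, rfl⟩, ht⟩ := (lt_isLUB_iff hd).1 (hAd hb)
    exact ⟨t, ((hfl a b).1.2 : _ ≤ b).trans_lt ht⟩
  choose tg htg using hG
  obtain ⟨t, ht⟩ := exists_gt_range_of_mk_lt tg hlt
  obtain ⟨g, hg, htg'⟩ := hcofinal t
  exact ((hc (ht ⟨g, hg⟩)).trans_le (htg'.trans (htg ⟨g, hg⟩).le)).false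

end ClubGuessing

/-! ### Sets interleaving with an increasing sequence modulo a filter. -/

section Increasing

open Filter

variable {Θ Λ T : Type (u + 1)} [LinearOrder Λ] [LinearOrder T]
  {F : Filter Θ} {f : Λ → Θ → Ordinal.{u}} {W : Θ → Set Ordinal.{u}}

/-- Every club of indices contains a chain of type `T` along which `f` is, modulo `F`, pointwise
above all earlier values of the chain, and which is pointwise bounded by some `f d`. -/
def HasIncreasingChains (F : Filter Θ) (f : Λ → Θ → Ordinal.{u}) (T : Type (u + 1)) [LinearOrder T] :
    Prop :=
  ∀ E : Set Λ, IsClub E → ∃ c : T → Λ, StrictMono c ∧ (∀ a, c a ∈ E) ∧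
    (∀ a, ∀ᶠ i in F, ∀ b ≤ a, f (c b) i ≤ f (c a) i) ∧ ∃ d, ∀ᶠ i in F, ∀ b, f (c b) i ≤ f d i

theorem HasIncreasingChains.mono {F' : Filter Θ} (h : HasIncreasingChains F f T) (hF : F' ≤ F) :
    HasIncreasingChains F' f T := fun E hE => by
  obtain ⟨c, h1, h2, h3, d, h4⟩ := h E hE
  exact ⟨c, h1, h2, fun a => (h3 a).filter_mono hF, d, h4.filter_mono hF⟩

/-- `W i` has an element in the interval `[f z i, f z' i)`. -/
def Meets (W : Θ → Set Ordinal.{u}) (f : Λ → Θ → Ordinal.{u}) (z z' : Λ) (i : Θ) : Prop :=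
  ∃ w ∈ W i, f z i ≤ w ∧ w < f z' i

/-- Modulo `F`, the sets `W i` interleave with the sequence `f`. -/
def Covers (F : Filter Θ) (W : Θ → Set Ordinal.{u}) (f : Λ → Θ → Ordinal.{u}) : Prop :=
  ∀ z, ∃ z', ∀ᶠ i in F, Meets W f z z' i

theorem eventually_le_of_le (hf : ∀ z z', z < z' → ∀ᶠ i in F, f z i < f z' i) {z z' : Λ}
    (h : z ≤ z') : ∀ᶠ i in F, f z i ≤ f z' i := by
  obtain rfl | h := h.eq_or_lt
  · simp
  · exact (hf z z' h).mono fun i hi => hi.le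

theorem exists_eq_of_mk_lt {α β : Type (u + 1)} (h : #β < #α) (g : α → β) :
    ∃ a b, a ≠ b ∧ g a = g b := by
  by_contra! H
  exact (mk_le_of_injective (f := g) fun a b hab => by_contra fun hne => H a b hne hab).not_gt h

theorem exists_lt_eq_of_mk_lt {β : Type (u + 1)} (h : #β < #T) (g : T → β) :
    ∃ a b, a < b ∧ g a = g b := by
  obtain ⟨a, b, hne, hab⟩ := exists_eq_of_mk_lt h g
  obtain h | h := hne.lt_or_gt
  · exact ⟨a, b, h, hab⟩
  · exact ⟨b, a, h, hab.symm⟩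

variable [WellFoundedLT Λ] [IsRegularCardinalOrder Λ] [WellFoundedLT T] [IsRegularCardinalOrder T]

/-- Otherwise a chain `c` of type `T` has, for each `a`, an index where `g` lies between the values
of `f` at `c a` and at the next point. There are fewer indices than places in the chain, so two
places share an index, against monotonicity there. -/
theorem exists_stable_exceeding (hf : ∀ z z', z < z' → ∀ᶠ i in F, f z i < f z' i)
    (h0 : ℵ₀ < #Λ) (hT : ℵ₀ ≤ #T) (hΘT : #Θ < #T) (hc : HasIncreasingChains F f T)
    (g : Θ → Ordinal.{u}) :
    ∃ m, ∀ z, ∀ᶠ i in F, g i < f z i → g i < f m i := by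
  by_contra! H
  choose n hn using H
  obtain ⟨c, hcm, hcE, hc1, -⟩ := hc _ (isClub_closurePoints h0 n)
  choose s hs1 hs2 using exists_succ_of_regular hT
  have key : ∀ a : T, ∃ i, f (c a) i ≤ g i ∧ g i < f (c (s a)) i ∧
      (∀ b ≤ a, f (c b) i ≤ f (c a) i) := by
    intro a
    have h1 : n (c a) < c (s a) := hcE (s a) _ (hcm (hs1 a))
    have h2 : ∃ᶠ i in F, g i < f (n (c a)) i ∧ f (c a) i ≤ g i := by
      have := hn (c a)
      simpa [not_eventually] using this
    obtain ⟨i, ⟨h3, h4⟩, h5, h6⟩ := (h2.and_eventually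
      ((hf _ _ h1).and (hc1 a))).exists
    exact ⟨i, h4, h3.trans h5, h6⟩
  choose ix h1 h2 h3 using key
  obtain ⟨a, b, hab, h⟩ := exists_lt_eq_of_mk_lt hΘT ix
  have h4 := h3 b (s a) (hs2 a b hab)
  have h5 := h2 a
  rw [h] at h5
  exact ((h5.trans_le h4).trans_le (h1 b)).false

/-- If `W` meets the sequence frequently, it covers it after restricting the filter. -/
theorem exists_covers_of_frequently_meets (hf : ∀ z z', z < z' → ∀ᶠ i in F, f z i < f z' i)
    (h0 : ℵ₀ < #Λ) (hT : ℵ₀ ≤ #T) (hΘT : #Θ < #T) (hc : HasIncreasingChains F f T)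
    (hW : ∀ z, ∃ z', ∃ᶠ i in F, Meets W f z z' i) :
    ∃ D : Set Θ, (∃ᶠ i in F, i ∈ D) ∧ Covers (F ⊓ 𝓟 D) W f := by
  have hm : ∀ z, ∃ m, ∀ z', ∀ᶠ i in F, Meets W f z z' i → Meets W f z m i := by
    intro z
    -- For the least `w ∈ W i` above `f z i`, meeting up to `z'` means `w < f z' i`. When there is
    -- no such `w`, the default value of `sInf` is never used.
    obtain ⟨m, hm⟩ := exists_stable_exceeding hf h0 hT hΘT hc
      (fun i => sInf {w ∈ W i | f z i ≤ w})
    refine ⟨m, fun z' => (hm z').mono fun i hi => ?_⟩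
    rintro ⟨w, hw, hw1, hw2⟩
    have hmem : sInf {w ∈ W i | f z i ≤ w} ∈ {w ∈ W i | f z i ≤ w} :=
      csInf_mem (s := {w ∈ W i | f z i ≤ w}) ⟨w, hw, hw1⟩
    exact ⟨_, hmem.1, hmem.2, hi ((csInf_le' (s := {w ∈ W i | f z i ≤ w}) ⟨hw, hw1⟩).trans_lt hw2)⟩
  choose m hm using hm
  have hanti : ∀ z z', z ≤ z' → ∀ᶠ i in F, Meets W f z' (m z') i → Meets W f z (m z) i := by
    intro z z' h
    filter_upwards [eventually_le_of_le hf h, hm z (m z')] with i h1 h2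
    rintro ⟨w, hw, hw1, hw2⟩
    exact h2 ⟨w, hw, h1.trans hw1, hw2⟩
  -- The sets of meeting indices decrease modulo `F`. If they never stabilised, a chain would give
  -- for each `a` an index where `W` meets the interval from `c a` to its successor, but nothing
  -- from there up to the bound `d`; a repeated index is contradictory.
  have hstab : ∃ z, ∀ z' ≥ z, ∀ᶠ i in F, Meets W f z (m z) i → Meets W f z' (m z') i := by
    by_contra! H
    choose n hnz hn using H
    obtain ⟨c, hcm, hcE, hc1, d, hd⟩ :=
      hc _ (isClub_closurePoints h0 fun z => max (n z) (m z))
    choose s hs1 hs2 using exists_succ_of_regular hT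
    have key : ∀ a : T, ∃ i, (∃ w ∈ W i, f (c a) i ≤ w ∧ w < f (c (s a)) i) ∧
        ¬ Meets W f (c (s a)) d i ∧ (∀ b ≤ a, f (c b) i ≤ f (c a) i) ∧
        ∀ b, f (c b) i ≤ f d i := by
      intro a
      have hlt := hcE (s a) _ (hcm (hs1 a))
      have h1 : n (c a) < c (s a) := (le_max_left _ _).trans_lt hlt
      have h2 : m (c a) < c (s a) := (le_max_right _ _).trans_lt hlt
      have h3 : ∃ᶠ i in F, Meets W f (c a) (m (c a)) i ∧
          ¬ Meets W f (n (c a)) (m (n (c a))) i := by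
        have := hn (c a)
        simpa [not_eventually] using this
      obtain ⟨i, ⟨⟨w, hw, hw1, hw2⟩, h5⟩, h6, h7, h8, h9, h10⟩ := (h3.and_eventually
        ((hf _ _ h2).and ((hanti _ _ h1.le).and
          ((hm (c (s a)) d).and ((hc1 a).and hd))))).exists
      exact ⟨i, ⟨w, hw, hw1, hw2.trans h6⟩, fun h => h5 (h7 (h8 h)), h9, h10⟩
    choose ix h1 h2 h3 h4 using key
    obtain ⟨a, b, hab, h⟩ := exists_lt_eq_of_mk_lt hΘT ix
    obtain ⟨w, hw, hw1, hw2⟩ := h1 b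
    refine h2 a ?_
    rw [h]
    exact ⟨w, hw, (h3 b (s a) (hs2 a b hab)).trans hw1, hw2.trans_le (h4 b _)⟩
  obtain ⟨z₀, hz₀⟩ := hstab
  refine ⟨{i | Meets W f z₀ (m z₀) i}, ?_, fun z => ⟨m z, ?_⟩⟩
  · obtain ⟨z', hz'⟩ := hW z₀
    exact hz'.mp (hm z₀ z')
  · rw [eventually_inf_principal]
    obtain h | h := le_total z₀ z
    · exact hz₀ z h
    · exact hanti z z₀ h

/-- Each step of a chain of type `T` places an element of some `W i` between consecutive values. By
pigeonhole one `i` serves `#T` many steps, and its elements increase strictly. -/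
theorem not_covers_of_mk_lt [F.NeBot] (hf : ∀ z z', z < z' → ∀ᶠ i in F, f z i < f z' i)
    (h0 : ℵ₀ < #Λ) (hT : ℵ₀ ≤ #T) (hΘT : #Θ < #T) (hc : HasIncreasingChains F f T)
    (hW : ∀ i, #(W i) < #T) : ¬ Covers F W f := by
  intro hcov
  choose n hn using hcov
  obtain ⟨c, hcm, hcE, hc1, -⟩ := hc _ (isClub_closurePoints h0 n)
  choose s hs1 hs2 using exists_succ_of_regular hT
  have key : ∀ a : T, ∃ i, ∃ w ∈ W i, f (c a) i ≤ w ∧ w < f (c (s a)) i ∧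
      (∀ b ≤ a, f (c b) i ≤ f (c a) i) := by
    intro a
    have h1 : n (c a) < c (s a) := hcE (s a) _ (hcm (hs1 a))
    obtain ⟨i, ⟨w, hw, hw1, hw2⟩, h5, h6⟩ := ((hn (c a)).and
      ((hf _ _ h1).and (hc1 a))).exists
    exact ⟨i, w, hw, hw1, hw2.trans h5, h6⟩
  choose ix w hw h1 h2 h3 using key
  obtain ⟨i, hi⟩ := infinite_pigeonhole ix hT (by
    rw [← Order.cof_eq_cardinalMk (α := T), Order.cof_ord_cof, Order.cof_eq_cardinalMk]
    exact hΘT)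
  have hmono : StrictMono fun a : ix ⁻¹' {i} => w a := by
    rintro ⟨a, ha⟩ ⟨b, hb⟩ hab
    simp only [mem_preimage, mem_singleton_iff] at ha hb
    have h4 := h3 b (s a) (hs2 a b hab)
    have h5 := h2 a
    have h6 := h1 b
    rw [ha] at h5
    rw [hb] at h4 h6
    exact (h5.trans_le h4).trans_le h6
  have hinj : Function.Injective fun a : ix ⁻¹' {i} => (⟨w a, by
      have := hw a
      have ha : ix a = i := a.2
      rwa [ha] at this⟩ : W i) := fun a b hab => hmono.injective (congrArg Subtype.val hab)
  exact ((hi.symm.le.trans (mk_le_of_injective hinj)).trans_lt (hW i)).false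

/-- Replace a cover by a smaller one: if few functions dominate, frequently, all indices of the
elements of `W`, then initial segments of `W` cover after restricting the filter. -/
theorem Covers.exists_smaller (hf : ∀ z z', z < z' → ∀ᶠ i in F, f z i < f z' i)
    (h0 : ℵ₀ < #Λ) (hT : ℵ₀ ≤ #T) (hΘT : #Θ < #T) (hc : HasIncreasingChains F f T)
    (hcov : Covers F W f) {l : Θ → Ordinal.{u}} (e : Θ → Ordinal.{u} → Ordinal.{u})
    (he : ∀ i, ∀ w ∈ W i, e i w < l i) (hl : ∀ i, 0 < l i) {J : Type (u + 1)} (hJ : #J < #Λ)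
    (g : J → Θ → Ordinal.{u})
    (hg : ∀ p : Θ → Ordinal.{u}, (∀ i, p i < l i) → ∃ j, ∃ᶠ i in F, p i ≤ g j i) :
    ∃ (j : J) (D : Set Θ), (∃ᶠ i in F, i ∈ D) ∧
      Covers (F ⊓ 𝓟 D) (fun i => {w ∈ W i | e i w ≤ g j i}) f := by
  choose n hn using hcov
  have hp : ∀ z, ∃ j, ∃ᶠ i in F, Meets (fun i => {w ∈ W i | e i w ≤ g j i}) f z (n z) i := by
    intro z
    classical
    -- The position in `W i` of an element chosen between `f z i` and `f (n z) i`.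
    let p : Θ → Ordinal.{u} := fun i => if h : Meets W f z (n z) i then e i h.choose else 0
    obtain ⟨j, hj⟩ := hg p fun i => by
      by_cases h : Meets W f z (n z) i
      · simp only [p, dif_pos h]; exact he i _ h.choose_spec.1
      · simp only [p, dif_neg h]; exact hl i
    refine ⟨j, hj.mp ((hn z).mono fun i h hle => ?_)⟩
    simp only [p, dif_pos h] at hle
    exact ⟨h.choose, ⟨h.choose_spec.1, hle⟩, h.choose_spec.2⟩
  choose jz hjz using hp
  -- By regularity of `Λ` and `#J < #Λ`, one `j` recurs cofinally.
  obtain ⟨j, hj⟩ : ∃ j, ∀ z, ∃ z' ≥ z, jz z' = j := by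
    by_contra! H
    choose b hb using H
    obtain ⟨y, hy⟩ := exists_gt_range_of_mk_lt b hJ
    exact hb (jz y) y (hy _).le rfl
  refine ⟨j, exists_covers_of_frequently_meets hf h0 hT hΘT hc fun z => ?_⟩
  obtain ⟨z', hz', rfl⟩ := hj z
  refine ⟨n z', (hjz z').mp ((eventually_le_of_le hf hz').mono fun i h => ?_)⟩
  rintro ⟨w, hw, hw1, hw2⟩
  exact ⟨w, hw, h.trans hw1, hw2⟩

end Increasing

/-! ### Iterated cardinal successors and enumerations of small sets. -/

section SuccIter

variable {c d : Cardinal.{u}} {a b : Ordinal.{u}}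

@[simp]
theorem succIter_zero (c : Cardinal.{u}) : succIter c 0 = c := by simp [succIter]

theorem succIter_add_one (c : Cardinal.{u}) (a : Ordinal.{u}) :
    succIter c (a + 1) = Order.succ (succIter c a) := by
  simp [succIter, ← add_assoc]

theorem succIter_lt_succIter (h : a < b) : succIter c a < succIter c b := by
  simpa [succIter] using h

theorem succIter_mono_right (h : a ≤ b) : succIter c a ≤ succIter c b := by
  simpa [succIter] using h

theorem le_succIter (c : Cardinal.{u}) (a : Ordinal.{u}) : c ≤ succIter c a := by
  simpa using succIter_mono_right (c := c) (zero_le (a := a))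

theorem exists_lt_succIter_of_isSuccLimit (ha : Order.IsSuccLimit a) (h : d < succIter c a) :
    ∃ b < a, d < succIter c b :=
  ((isNormal_preAleph.comp (isNormal_add_right _)).lt_iff_exists_lt ha).1 h

end SuccIter

section Enumeration

variable {α : Type (u + 1)} {X : Set α} {c : Cardinal.{u}}

theorem exists_injOn_lt_ord (h : #X ≤ lift.{u + 1} c) :
    ∃ e : α → Ordinal.{u}, InjOn e X ∧ ∀ x ∈ X, e x < c.ord := by
  rw [← mk_Iio_ord_card] at h
  obtain ⟨e⟩ := h
  classical
  refine ⟨fun x => if h : x ∈ X then (e ⟨x, h⟩ : Ordinal) else 0, fun x hx y hy hxy => ?_,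
    fun x hx => ?_⟩
  · simp only [dif_pos hx, dif_pos hy] at hxy
    exact congrArg Subtype.val (e.injective (Subtype.ext hxy))
  · simp only [dif_pos hx]
    exact (e ⟨x, hx⟩).2

theorem mk_le_of_injOn_le {e : α → Ordinal.{u}} (he : InjOn e X) {o : Ordinal.{u}}
    (h : ∀ x ∈ X, e x ≤ o) (ho : o.card ≤ c) (hc : ℵ₀ ≤ c) : #X ≤ lift.{u + 1} c := by
  have h1 : #X ≤ #(Iio (o + 1)) :=
    mk_le_of_injective (f := fun x : X => (⟨e x, Order.lt_add_one_iff.2 (h x x.2)⟩ : Iio (o + 1)))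
      fun x y hxy => Subtype.ext (he x.2 y.2 (congrArg Subtype.val hxy))
  refine h1.trans ?_
  rw [Cardinal.mk_Iio_ordinal, Cardinal.lift_le, card_add_one]
  exact add_le_of_le hc ho (one_le_aleph0.trans hc)

end Enumeration

/-! ### Domination in products of the cardinals `(k i)^{+a}` by small functions. -/

section Domination

open Filter

variable {θ μ : Cardinal.{u}} {k : Iio θ.ord → Cardinal.{u}}

/-- The function `c` is, uniformly, below `k i ^ {+a}` in size: either bounded by `k i ^ {+b}` for a
fixed `b < a`, or by a fixed `k j`. -/
def IsSmallAt (k : Iio θ.ord → Cardinal.{u}) (a : Ordinal.{u}) (c : Iio θ.ord → Cardinal.{u}) :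
    Prop :=
  (∃ b < a, ∀ i, c i ≤ succIter (k i) b) ∨ ∃ j, ∀ i, c i ≤ k j

/-- On each stationary set of limits, at most `μ ^ {+a}` many small functions dominate, each time on
a stationary subset, all members of the product of the `k i ^ {+a}`. -/
def HasSmallDomination (k : Iio θ.ord → Cardinal.{u}) (μ : Cardinal.{u}) (a : Ordinal.{u}) :
    Prop :=
  ∀ S : Set (Iio θ.ord), IsStationary S → (∀ i ∈ S, Order.IsSuccLimit i) →
    ∃ (J : Type (u + 1)) (g : J → Iio θ.ord → Ordinal.{u}),
      #J ≤ lift.{u + 1} (succIter μ a) ∧ (∀ j, IsSmallAt k a fun i => (g j i).card) ∧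
      ∀ p : Iio θ.ord → Ordinal.{u}, (∀ i, p i < (succIter (k i) a).ord) →
        ∃ j, IsStationary {i ∈ S | p i ≤ g j i}

/-- Descent on `b`: domination at `b` replaces `W` by initial segments that still cover on a
stationary subset. Their sizes have a smaller exponent, or are at most a fixed `k j'`, where chains
of length `(k j')^+` exclude a cover. -/
theorem not_covers_of_hasSmallDomination (hθ : θ.IsRegular) (hθ0 : ℵ₀ < θ) (hθk : ∀ i, θ < k i)
    {a : Ordinal.{u}} (hdom : ∀ b < a, HasSmallDomination k μ b)
    {Λ : Type (u + 1)} [LinearOrder Λ] [WellFoundedLT Λ] [IsRegularCardinalOrder Λ]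
    (h0 : ℵ₀ < #Λ) (hΛ : ∀ b < a, lift.{u + 1} (succIter μ b) < #Λ)
    {S₀ : Set (Iio θ.ord)} (hS₀ : ∀ i ∈ S₀, Order.IsSuccLimit i)
    {f : Λ → Iio θ.ord → Ordinal.{u}}
    (hf : ∀ z z', z < z' → ∀ᶠ i in clubFilter (Iio θ.ord) ⊓ 𝓟 S₀, f z i < f z' i)
    (hc : ∀ j, HasIncreasingChains (clubFilter (Iio θ.ord) ⊓ 𝓟 S₀) f
      (Iio (Order.succ (k j)).ord))
    {b : Ordinal.{u}} (hb : b < a) {S : Set (Iio θ.ord)} (hS : IsStationary S) (hSS : S ⊆ S₀)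
    {W : Iio θ.ord → Set Ordinal.{u}} (hW : ∀ i, #(W i) ≤ lift.{u + 1} (succIter (k i) b)) :
    ¬ Covers (clubFilter (Iio θ.ord) ⊓ 𝓟 S) W f := by
  have := isRegularCardinalOrder_Iio hθ
  have hΘ : #(Iio θ.ord) = lift.{u + 1} θ := mk_Iio_ord_card θ
  have hcof : Order.cof (Iio θ.ord) ≠ ℵ₀ := cof_ne_aleph0_of_regular (by rw [hΘ]; simpa)
  have hk0 : ∀ i, ℵ₀ ≤ k i := fun i => (hθ0.trans (hθk i)).le
  have hTreg : ∀ j, IsRegularCardinalOrder (Iio (Order.succ (k j)).ord) := fun j =>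
    isRegularCardinalOrder_Iio (isRegular_succ (hk0 j))
  have hTcard : ∀ j, #(Iio (Order.succ (k j)).ord) = lift.{u + 1} (Order.succ (k j)) := fun j =>
    mk_Iio_ord_card _
  have hT0 : ∀ j, ℵ₀ ≤ #(Iio (Order.succ (k j)).ord) := fun j => by
    rw [hTcard, aleph0_le_lift]; exact (hk0 j).trans (Order.le_succ _)
  have hΘT : ∀ j, #(Iio θ.ord) < #(Iio (Order.succ (k j)).ord) := fun j => by
    rw [hTcard, hΘ, Cardinal.lift_lt]; exact (hθk j).trans (Order.lt_succ _)
  have hle : ∀ {S : Set (Iio θ.ord)}, S ⊆ S₀ →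
      clubFilter (Iio θ.ord) ⊓ 𝓟 S ≤ clubFilter (Iio θ.ord) ⊓ 𝓟 S₀ := fun h =>
    inf_le_inf_left _ (principal_mono.2 h)
  induction b using WellFoundedLT.induction generalizing S W with | ind b IH
  intro hcov
  choose e he he' using fun i => exists_injOn_lt_ord (hW i)
  obtain ⟨J, g, hJ, hsmall, hg⟩ := hdom b hb S hS fun i hi => hS₀ i (hSS hi)
  obtain ⟨i₀, -⟩ := hS.nonempty
  obtain ⟨j, D, hD, hcovD⟩ := hcov.exists_smaller
    (fun z z' h => (hf z z' h).filter_mono (hle hSS)) h0 (hT0 i₀) (hΘT i₀)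
    ((hc i₀).mono (hle hSS)) e he'
    (fun i => by
      rw [Cardinal.lt_ord, card_zero]
      exact aleph0_pos.trans_le ((hk0 i).trans (le_succIter _ _))) (hJ.trans_lt (hΛ b hb)) g
    (fun p hp => by
      obtain ⟨j, hj⟩ := hg p hp
      exact ⟨j, (frequently_clubFilter_inf_iff hcof).2 hj⟩)
  rw [frequently_clubFilter_inf_iff hcof] at hD
  rw [inf_assoc, inf_principal] at hcovD
  have hmem : {i ∈ S | i ∈ D} = S ∩ D := rfl
  rw [hmem] at hD
  have hsub : S ∩ D ⊆ S₀ := inter_subset_left.trans hSS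
  have hinj : ∀ i, InjOn (e i) {w ∈ W i | e i w ≤ g j i} := fun i => (he i).mono (sep_subset _ _)
  obtain ⟨b', hb', hsm⟩ | ⟨j', hsm⟩ := hsmall j
  · exact IH b' hb' (hb'.trans hb) hD hsub (fun i => mk_le_of_injOn_le (hinj i)
      (fun w hw => hw.2) (hsm i) ((hk0 i).trans (le_succIter _ _))) hcovD
  · have := (clubFilter_inf_neBot_iff hcof).2 hD
    refine not_covers_of_mk_lt (fun z z' h => (hf z z' h).filter_mono (hle hsub)) h0 (hT0 j')
      (hΘT j') ((hc j').mono (hle hsub)) (fun i => ?_) hcovD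
    rw [hTcard]
    exact (mk_le_of_injOn_le (hinj i) (fun w hw => hw.2) (hsm i) (hk0 j')).trans_lt
      (Cardinal.lift_lt.2 (Order.lt_succ _))

/-- At a limit `i`, continuity puts `p i` below some `k j` with `j < i`; Fodor makes `j` constant,
so constant functions suffice. -/
theorem hasSmallDomination_zero (hθ : θ.IsRegular) (hθ0 : ℵ₀ < θ) (hθμ : θ < μ)
    (hk : Order.IsNormal k) : HasSmallDomination k μ 0 := by
  have := isRegularCardinalOrder_Iio hθ
  have hΘ : #(Iio θ.ord) = lift.{u + 1} θ := mk_Iio_ord_card θ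
  intro S hS hlim
  refine ⟨Iio θ.ord, fun j _ => (k j).ord, ?_, fun j => .inr ⟨j, by simp⟩, fun p hp => ?_⟩
  · rw [hΘ, Cardinal.lift_le, succIter_zero]
    exact hθμ.le
  · have H : ∀ i, ∃ j, i ∈ S → j < i ∧ p i < (k j).ord := by
      intro i
      by_cases hi : i ∈ S
      · have h1 := hp i
        rw [succIter_zero, Cardinal.lt_ord, hk.lt_iff_exists_lt (hlim i hi)] at h1
        obtain ⟨j, hj, h⟩ := h1
        exact ⟨j, fun _ => ⟨hj, Cardinal.lt_ord.2 h⟩⟩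
      · exact ⟨i, fun h => absurd h hi⟩
    choose r hr using H
    obtain ⟨j, hj⟩ := exists_isStationary_fiber (by rw [hΘ]; simpa) hS r fun i hi => (hr i hi).1
    refine ⟨j, hj.mono ?_⟩
    rintro i ⟨hi, rfl⟩
    exact ⟨hi, (hr i hi).2.le⟩

theorem hasSmallDomination_of_isSuccLimit (hθ : θ.IsRegular) (hθ0 : ℵ₀ < θ) (hθμ : θ < μ)
    {a : Ordinal.{u}} (ha : Order.IsSuccLimit a) (haθ : a < θ.ord) : HasSmallDomination k μ a := by
  have := isRegularCardinalOrder_Iio hθ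
  have hΘ : #(Iio θ.ord) = lift.{u + 1} θ := mk_Iio_ord_card θ
  have haθ' := Cardinal.lt_ord.1 haθ
  intro S hS hlim
  refine ⟨Iio a, fun b i => (succIter (k i) b).ord, ?_, fun b => .inl ⟨b, b.2, by simp⟩,
    fun p hp => ?_⟩
  · rw [Cardinal.mk_Iio_ordinal, Cardinal.lift_le]
    exact haθ'.le.trans (hθμ.le.trans (le_succIter _ _))
  -- Each `p i` falls below some exponent `b < a`, and fewer than `θ` exponents split `S`, so one
  -- piece is stationary.
  · rw [← isStationary_iUnion_iff (cof_ne_aleph0_of_regular (by rw [hΘ]; simpa))]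
    · refine hS.mono fun i hi => mem_iUnion.2 ?_
      obtain ⟨b, hb, h⟩ := exists_lt_succIter_of_isSuccLimit ha (Cardinal.lt_ord.1 (hp i))
      exact ⟨⟨b, hb⟩, hi, (Cardinal.lt_ord.2 h).le⟩
    · rw [Order.cof_eq_cardinalMk, Cardinal.lift_lt, hΘ, Cardinal.mk_Iio_ordinal,
        Cardinal.lift_lt]
      exact haθ'

/-- If all families of at most `#Λ` members of the product of the `l i` are bounded modulo `F`,
there is an increasing sequence of length `Λ` that also bounds its small pieces `C q`. -/
theorem exists_increasing_sequence {Θ Λ Q : Type (u + 1)} [LinearOrder Λ] [WellFoundedLT Λ]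
    {F : Filter Θ} {l : Θ → Ordinal.{u}} (hl : ∀ i, 0 < l i)
    (hbdd : ∀ (ι : Type (u + 1)) (g : ι → Θ → Ordinal.{u}), #ι ≤ #Λ → (∀ j i, g j i < l i) →
      ∃ p : Θ → Ordinal.{u}, (∀ i, p i < l i) ∧ ∀ j, ∀ᶠ i in F, g j i < p i)
    (h0 : ℵ₀ ≤ #Λ) (hQ : #Q ≤ #Λ) (C : Q → Set Λ)
    (hC : ∀ q, ∀ᶠ i in F, Cardinal.lift.{u} #(C q) < (Ordinal.lift.{u + 1} (l i)).cof) :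
    ∃ f : Λ → Θ → Ordinal.{u}, (∀ z i, f z i < l i) ∧
      (∀ z z', z < z' → ∀ᶠ i in F, f z i < f z' i) ∧
      ∀ q z, ∀ᶠ i in F, ∀ y ∈ C q, y < z → f y i ≤ f z i := by
  let P := {p : Θ → Ordinal.{u} // ∀ i, p i < l i}
  have step : ∀ (z : Λ) (prev : ∀ y, y < z → P), ∃ p : P,
      (∀ y h, ∀ᶠ i in F, (prev y h).1 i < p.1 i) ∧
      ∀ q, ∀ᶠ i in F, ∀ y (h : y < z), y ∈ C q → (prev y h).1 i ≤ p.1 i := by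
    intro z prev
    classical
    let s : Q → Θ → Ordinal.{u} := fun q i => ⨆ y : {y : C q // (y : Λ) < z}, (prev y y.2).1 i
    obtain ⟨p, hp, hpb⟩ := hbdd (Iio z ⊕ Q)
      -- Besides all earlier terms, the new term must bound the pointwise supremum over each `C q`.
      -- That supremum is below `l i` for almost all `i`; the value 0 covers the others.
      (Sum.elim (fun y i => (prev y y.2).1 i) (fun q i => if s q i < l i then s q i else 0))
      (by
        rw [mk_sum, Cardinal.lift_id, Cardinal.lift_id]
        exact add_le_of_le h0 (mk_set_le _) hQ)
      (by
        rintro (y | q) i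
        · exact (prev y y.2).2 i
        · simp only [Sum.elim_inr]
          split_ifs with h
          exacts [h, hl i])
    refine ⟨⟨p, hp⟩, fun y h => hpb (Sum.inl ⟨y, h⟩), fun q => ?_⟩
    filter_upwards [hC q, hpb (Sum.inr q)] with i h1 h2 y hy hyC
    have hs : s q i < l i := by
      refine Ordinal.lift_iSup_lt_of_lt_cof ((Cardinal.lift_le.2 ?_).trans_lt h1)
        fun y => (prev y y.2).2 i
      exact mk_subtype_le _
    simp only [Sum.elim_inr, if_pos hs] at h2
    refine le_trans ?_ h2.le
    refine le_ciSup (f := fun y : {y : C q // (y : Λ) < z} => (prev y y.2).1 i) ?_ ⟨⟨y, hyC⟩, hy⟩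
    exact ⟨l i, by rintro _ ⟨y, rfl⟩; exact ((prev y y.2).2 i).le⟩
  choose nxt hn1 hn2 using step
  have hfix : ∀ z, (wellFounded_lt (α := Λ)).fix nxt z =
      nxt z fun y _ => (wellFounded_lt (α := Λ)).fix nxt y := fun z =>
    (wellFounded_lt (α := Λ)).fix_eq nxt z
  refine ⟨fun z => ((wellFounded_lt (α := Λ)).fix nxt z).1,
    fun z => ((wellFounded_lt (α := Λ)).fix nxt z).2, fun z z' h => ?_, fun q z => ?_⟩
  · have := hn1 z' (fun y _ => (wellFounded_lt (α := Λ)).fix nxt y) z h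
    rwa [← hfix] at this
  · have := hn2 z (fun y _ => (wellFounded_lt (α := Λ)).fix nxt y) q
    rw [← hfix] at this
    exact this.mono fun i h y hy hyz => h y hyz hy

theorem hasSmallDomination_add_one (hθ : θ.IsRegular) (hθ0 : ℵ₀ < θ)
    (hk : Order.IsNormal k) (hkμ : IsLUB (range k) μ) (hθk : ∀ i, θ < k i) {b : Ordinal.{u}}
    (hdom : ∀ b' < b + 1, HasSmallDomination k μ b') : HasSmallDomination k μ (b + 1) := by
  have := isRegularCardinalOrder_Iio hθ
  have hΘ : #(Iio θ.ord) = lift.{u + 1} θ := mk_Iio_ord_card θ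
  have hΘ0 : ℵ₀ < #(Iio θ.ord) := by rw [hΘ]; simpa
  have hcof : Order.cof (Iio θ.ord) ≠ ℵ₀ := cof_ne_aleph0_of_regular hΘ0
  have hk0 : ∀ i, ℵ₀ ≤ k i := fun i => (hθ0.trans (hθk i)).le
  have hsucc : ∀ j, ∃ j', j < j' := fun j => by
    obtain ⟨j', h, -⟩ := exists_succ_of_regular hΘ0.le j
    exact ⟨j', h⟩
  have hkltμ : ∀ i, k i < μ := fun i => by
    obtain ⟨i', h⟩ := hsucc i
    exact (hk.strictMono h).trans_le (hkμ.1 ⟨i', rfl⟩)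
  have hksucc : ∀ i, Order.succ (k i) < μ := fun i => by
    obtain ⟨i', h⟩ := hsucc i
    exact (Order.succ_le_of_lt (hk.strictMono h)).trans_lt (hkltμ i')
  have hksucc2 : ∀ i, Order.succ (Order.succ (k i)) < μ := fun i => by
    obtain ⟨i', h⟩ := hsucc i
    exact (Order.succ_le_succ (Order.succ_le_of_lt (hk.strictMono h))).trans_lt (hksucc i')
  intro S hS hlim
  by_contra! H
  obtain ⟨i₀, -⟩ := hS.nonempty
  have hμ0 : ℵ₀ ≤ μ := (hk0 i₀).trans (hkltμ i₀).le
  let σ := succIter μ (b + 1)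
  have hσ : σ.IsRegular := by
    simp only [σ, succIter_add_one]
    exact isRegular_succ (hμ0.trans (le_succIter _ _))
  have hμσ : μ < σ := by
    simp only [σ, succIter_add_one]
    exact Order.lt_succ_of_le (le_succIter _ _)
  let Λ := Iio σ.ord
  have hΛreg : IsRegularCardinalOrder Λ := isRegularCardinalOrder_Iio hσ
  have hΛ : #Λ = lift.{u + 1} σ := mk_Iio_ord_card σ
  have hΛ0 : ℵ₀ < #Λ := by rw [hΛ, aleph0_lt_lift]; exact hμ0.trans_lt hμσ
  let l : Iio θ.ord → Ordinal.{u} := fun i => (succIter (k i) (b + 1)).ord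
  have hlreg : ∀ i, (succIter (k i) (b + 1)).IsRegular := fun i => by
    rw [succIter_add_one]
    exact isRegular_succ ((hk0 i).trans (le_succIter _ _))
  have hcard : ∀ {o : Ordinal.{u}} {i}, o < l i → o.card ≤ succIter (k i) b := fun {o i} h => by
    simpa [l, succIter_add_one, Cardinal.lt_ord] using h
  -- Any function in the product is small, being bounded in size by exponent `b`, so failure of
  -- domination means boundedness of every family of size at most `σ`.
  have hbdd : ∀ (ι : Type (u + 1)) (g : ι → Iio θ.ord → Ordinal.{u}), #ι ≤ #Λ →
      (∀ j i, g j i < l i) → ∃ p : Iio θ.ord → Ordinal.{u}, (∀ i, p i < l i) ∧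
        ∀ j, ∀ᶠ i in clubFilter (Iio θ.ord) ⊓ 𝓟 S, g j i < p i := by
    intro ι g hι hg
    obtain ⟨p, hp, hpg⟩ := H ι g (hι.trans hΛ.le)
      fun j => .inl ⟨b, Order.lt_add_one_iff.2 le_rfl, fun i => hcard (hg j i)⟩
    refine ⟨p, hp, fun j => ?_⟩
    have h1 := hpg j
    rw [← frequently_clubFilter_inf_iff hcof] at h1
    simpa [not_frequently] using h1
  have hTreg : ∀ j, IsRegularCardinalOrder (Iio (Order.succ (k j)).ord) := fun j =>
    isRegularCardinalOrder_Iio (isRegular_succ (hk0 j))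
  have hTcard : ∀ j, #(Iio (Order.succ (k j)).ord) = lift.{u + 1} (Order.succ (k j)) := fun j =>
    mk_Iio_ord_card _
  have hguess := fun j => exists_club_guessing (Λ := Λ) (T := Iio (Order.succ (k j)).ord)
    (by rw [hTcard, aleph0_le_lift]; exact (hk0 j).trans (Order.le_succ _))
    (by rw [hTcard, hΛ, ← Cardinal.lift_succ, Cardinal.lift_lt]; exact (hksucc2 j).trans hμσ)
  choose C hC1 hC2 using hguess
  obtain ⟨f, hfl, hf, hfC⟩ := exists_increasing_sequence (Q := Iio θ.ord × Λ) (l := l)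
    (fun i => (hlreg i).ord_pos) hbdd hΛ0.le
    (by
      rw [mk_prod, Cardinal.lift_id, Cardinal.lift_id]
      refine mul_le_of_le hΛ0.le ?_ le_rfl
      rw [hΘ, hΛ, Cardinal.lift_le]
      exact ((hθk i₀).trans ((hkltμ i₀).trans hμσ)).le)
    (fun q => C q.1 q.2) (by
      intro q
      have h1 : ∀ᶠ i in clubFilter (Iio θ.ord) ⊓ 𝓟 S, i ∈ Ioi q.1 :=
        mem_inf_of_left (mem_clubFilter_of_isClub (isClub_Ioi hΘ0 q.1))
      filter_upwards [h1] with i hi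
      rw [← Ordinal.lift_cof, (hlreg i).cof_ord]
      -- The guesses for `k j` have size at most `(k j)^+`, which is at most `k i` once `i > j`;
      -- their suprema thus stay in the product for almost all `i`.
      have h2 : Order.succ (k q.1) < succIter (k i) (b + 1) := by
        rw [succIter_add_one]
        exact Order.lt_succ_of_le
          ((Order.succ_le_of_lt (hk.strictMono hi)).trans (le_succIter _ _))
      have h3 := (hC1 q.1 q.2).trans_lt ((hTcard q.1).trans_lt (Cardinal.lift_lt.2 h2))
      rwa [Cardinal.lift_id'.{u, u + 1}])
  have hchains : ∀ j, HasIncreasingChains (clubFilter (Iio θ.ord) ⊓ 𝓟 S) f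
      (Iio (Order.succ (k j)).ord) := by
    intro j E hE
    obtain ⟨d, hdE, hdT⟩ := hC2 j E hE
    obtain ⟨c, hc, hcC⟩ := exists_strictMono_of_mk_le hdT
    obtain ⟨y, hy⟩ := exists_gt_of_mk_lt (s := C j d) ((hC1 j d).trans_lt (by
      rw [hTcard, hΛ, Cardinal.lift_lt]; exact (hksucc j).trans hμσ))
    refine ⟨c, hc, fun a => hdE (hcC a), fun a => ?_, y, ?_⟩
    · filter_upwards [hfC (j, d) (c a)] with i hi b' hb'
      obtain rfl | h := hb'.eq_or_lt
      · exact le_rfl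
      · exact hi _ (hcC b') (hc h)
    · filter_upwards [hfC (j, d) y] with i hi b'
      exact hi _ (hcC b') (hy _ (hcC b'))
  obtain ⟨h, hh, hhf⟩ := hbdd Λ f le_rfl hfl
  refine not_covers_of_hasSmallDomination hθ hθ0 hθk hdom hΛ0 (fun b' hb' => ?_) hlim hf hchains
    (Order.lt_add_one_iff.2 le_rfl : b < b + 1) hS subset_rfl (W := fun i => Iio (h i))
    (fun i => ?_) fun z => ?_
  · rw [hΛ, Cardinal.lift_lt]
    exact succIter_lt_succIter hb'
  · rw [Cardinal.mk_Iio_ordinal, Cardinal.lift_le]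
    exact hcard (hh i)
  · obtain ⟨z', hz', -⟩ := exists_succ_of_regular hΛ0.le z
    refine ⟨z', ?_⟩
    filter_upwards [hhf z, hf z z' hz'] with i h1 h2
    exact ⟨f z i, h1, le_rfl, h2⟩

theorem hasSmallDomination (hθ : θ.IsRegular) (hθ0 : ℵ₀ < θ) (hθμ : θ < μ)
    (hk : Order.IsNormal k) (hkμ : IsLUB (range k) μ) (hθk : ∀ i, θ < k i) {a : Ordinal.{u}}
    (ha : a < θ.ord) : HasSmallDomination k μ a := by
  induction a using WellFoundedLT.induction with | ind a IH
  obtain rfl | ⟨b, rfl⟩ | hlim := Ordinal.zero_or_succ_or_isSuccLimit a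
  · exact hasSmallDomination_zero hθ hθ0 hθμ hk
  · exact hasSmallDomination_add_one hθ hθ0 hk hkμ hθk fun b' hb' => IH b' hb' (hb'.trans ha)
  · exact hasSmallDomination_of_isSuccLimit hθ hθ0 hθμ hlim ha

end Domination

theorem exists_isDenseIn_mk_eq_density {P : Type u} [PartialOrder P] (B : Set P) :
    ∃ A ⊆ B, IsDenseIn A B ∧ #A = density B := by
  have := csInf_mem (s := {c | ∃ A : Set P, A ⊆ B ∧ IsDenseIn A B ∧ #A = c})
    ⟨#B, B, subset_rfl, fun y hy => ⟨y, hy, le_rfl⟩, rfl⟩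
  exact this

theorem mk_iUnion_le_of_le {ι α : Type u} {X : ι → Set α} {L : Cardinal.{u}} (hL : ℵ₀ ≤ L)
    (hι : #ι ≤ L) (hX : ∀ i, #(X i) ≤ L) : #(⋃ i, X i) ≤ L :=
  (mk_iUnion_le X).trans (mul_le_of_le hL hι (ciSup_le' hX))

/-! ### Bounding the antichain. -/

section Antichain

variable {κ θ μ : Cardinal.{u}} {k : Iio θ.ord → Cardinal.{u}} {A : Set (Set Ordinal.{u})}

theorem exists_ge_of_mem_upperSubsets {Y : Set Ordinal.{u}} (hY : Y ∈ upperSubsets μ θ)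
    {a : Ordinal.{u}} (ha : a < μ.ord) : ∃ y ∈ Y, a ≤ y := by
  by_contra! H
  have h1 : Y ∩ Iio a = Y := inter_eq_left.2 H
  have h2 := hY.2 a ha
  rw [h1, hY.1.2] at h2
  exact h2.false

/-- As `θ` is the cofinality of `μ`, an unbounded intersection has size `θ`, hence is a common lower
bound in the upper part. -/
theorem IsAntichainIn.eq_of_inter_unbounded (hθ : θ = μ.ord.cof) (hμ : ℵ₀ ≤ μ)
    (hA : IsAntichainIn A (upperSubsets μ θ)) {X Y : Set Ordinal.{u}} (hX : X ∈ A) (hY : Y ∈ A)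
    (h : ∀ a < μ.ord, ∃ x ∈ X ∩ Y, a ≤ x) : X = Y := by
  by_contra hne
  have hXU := hA.1 hX
  have hsub : X ∩ Y ⊆ Iio μ.ord := inter_subset_left.trans hXU.1.1
  refine hA.2 X hX Y hY hne ⟨X ∩ Y, ⟨⟨hsub, le_antisymm ?_ ?_⟩, fun a ha => ?_⟩,
    inter_subset_left, inter_subset_right⟩
  · exact (mk_le_mk_of_subset inter_subset_left).trans hXU.1.2.le
  · by_contra! hlt
    have hs : sSup (X ∩ Y) < μ.ord := by
      refine Ordinal.sSup_lt_of_lt_cof ?_ hsub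
      rwa [← Ordinal.lift_cof, ← hθ]
    obtain ⟨x, hx, hx'⟩ := h _ ((isSuccLimit_ord hμ).succ_lt hs)
    exact ((Order.succ_le_iff.1 hx').trans_le (le_csSup ⟨μ.ord, fun y hy => (hsub hy).le⟩ hx)).false
  · exact (mk_le_mk_of_subset (inter_subset_inter_left _ inter_subset_left)).trans_lt
      (hXU.2 a ha)

theorem isCofinal_of_isStationary {α : Type u} [LinearOrder α] [WellFoundedLT α]
    [IsRegularCardinalOrder α] (h0 : ℵ₀ < #α) {S : Set α} (hS : IsStationary S) : IsCofinal S := by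
  intro a
  obtain ⟨b, hb, hab⟩ := hS (isClub_Ioi h0 a)
  exact ⟨b, hb, hab.le⟩

/-- If the sizes of the `D i` are bounded below `μ`, each member of the antichain is determined by a
member of a dense family of bounded sets: a piece of the graph of its choice function. -/
theorem mk_le_lowerDensity (hθ : θ = μ.ord.cof) (hθr : θ.IsRegular) (hθ0 : ℵ₀ < θ) (hθμ : θ < μ)
    (hkμ : IsLUB (range k) μ) (hkltμ : ∀ i, k i < μ) (hk : StrictMono k) (hk0 : ∀ i, ℵ₀ ≤ k i)
    (hA : IsAntichainIn A (upperSubsets μ θ)) {D : Iio θ.ord → Set (Set Ordinal.{u})}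
    (hD : ∀ i, ∀ Y ∈ D i, ∀ a < (k i).ord, ∃ y ∈ Y, a ≤ y) {j : Iio θ.ord}
    (hDj : ∀ i, #(D i) ≤ lift.{u + 1} (k j)) {B : Set (Set Ordinal.{u})} (hB : B ⊆ A)
    (hst : ∀ X ∈ B, IsStationary {i | ∃ Y ∈ D i, Y ⊆ X}) : #B ≤ lowerDensity μ θ := by
  have := isRegularCardinalOrder_Iio hθr
  have hΘ : #(Iio θ.ord) = lift.{u + 1} θ := mk_Iio_ord_card θ
  have hΘ0 : ℵ₀ < #(Iio θ.ord) := by rw [hΘ]; simpa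
  have hμ0 : ℵ₀ ≤ μ := (hk0 j).trans (hkltμ j).le
  choose e he he' using fun i => exists_injOn_lt_ord (hDj i)
  choose! Y hYD hYX using fun (X : Set Ordinal.{u}) (i : Iio θ.ord) (h : ∃ Y ∈ D i, Y ⊆ X) => h
  -- Euclidean division by `(k j).ord` recovers the pair; all codes stay below `(k j).ord * θ.ord <
  -- μ.ord`, so the coded graphs are bounded.
  let code : Iio θ.ord → Ordinal.{u} → Ordinal.{u} := fun i v => (k j).ord * i + v
  have hcode : ∀ i i' v v', v < (k j).ord → v' < (k j).ord → code i v = code i' v' →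
      i = i' ∧ v = v' := by
    intro i i' v v' hv hv' h
    have hpos : (k j).ord ≠ 0 := (zero_le.trans_lt hv).ne'
    have h1 : (i : Ordinal) = i' := by
      have := congrArg (· / (k j).ord) h
      simpa [code, mul_add_div _ hpos, div_eq_zero_of_lt hv, div_eq_zero_of_lt hv'] using this
    have h2 : i = i' := Subtype.ext h1
    subst h2
    exact ⟨rfl, by simpa [code] using h⟩
  let top : Ordinal.{u} := (k j).ord * θ.ord
  have htop : top < μ.ord := by
    rw [Cardinal.lt_ord, Ordinal.card_mul, card_ord, card_ord]
    exact mul_lt_of_lt hμ0 (hkltμ j) hθμ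
  have hcodelt : ∀ i v, v < (k j).ord → code i v < top := by
    intro i v hv
    have h1 : Order.succ (i : Ordinal) ≤ θ.ord := Order.succ_le_of_lt i.2
    calc code i v < (k j).ord * i + (k j).ord := by simpa [code] using hv
      _ = (k j).ord * Order.succ (i : Ordinal) := by rw [mul_succ]
      _ ≤ top := mul_le_mul_right h1 _
  let S : Set Ordinal.{u} → Set (Iio θ.ord) := fun X => {i | ∃ Y ∈ D i, Y ⊆ X}
  let G : Set Ordinal.{u} → Set Ordinal.{u} := fun X => (fun i => code i (e i (Y X i))) '' S X
  have hG : ∀ X ∈ B, G X ∈ lowerSubsets μ θ := by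
    intro X hX
    have hlt : G X ⊆ Iio top := by
      rintro _ ⟨i, hi, rfl⟩
      exact hcodelt i _ (he' i _ (hYD X i hi))
    refine ⟨⟨fun x hx => (hlt hx).trans htop, ?_⟩, top, htop, hlt⟩
    rw [mk_image_eq_of_injOn, ← hΘ]
    · refine le_antisymm (mk_set_le _) ?_
      rw [← Order.cof_eq_cardinalMk (α := Iio θ.ord)]
      exact Order.cof_le (isCofinal_of_isStationary hΘ0 (hst X hX))
    · intro i hi i' hi' h
      exact (hcode _ _ _ _ (he' i _ (hYD X i hi)) (he' i' _ (hYD X i' hi')) h).1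
  obtain ⟨Dn, hDn, hdense, hcard⟩ := exists_isDenseIn_mk_eq_density (lowerSubsets μ θ)
  choose! Z hZD hZG using fun (X : Set Ordinal.{u}) (h : X ∈ B) => hdense (G X) (hG X h)
  rw [lowerDensity, ← hcard]
  refine mk_le_of_injective (f := fun X : B => (⟨Z X, hZD X X.2⟩ : Dn)) ?_
  rintro ⟨X, hX⟩ ⟨X', hX'⟩ hXX'
  have hZ : Z X = Z X' := congrArg Subtype.val hXX'
  refine Subtype.ext (hA.eq_of_inter_unbounded hθ hμ0 (hB hX) (hB hX') fun a ha => ?_)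
  obtain ⟨i₀, hi₀⟩ : ∃ i, a < (k i).ord := by
    obtain ⟨_, ⟨i, rfl⟩, hi⟩ := (lt_isLUB_iff hkμ).1 (Cardinal.lt_ord.1 ha)
    exact ⟨i, Cardinal.lt_ord.2 hi⟩
  -- Indices below `i₀` account for fewer than `θ` codes, while `Z X` has `θ`. A shared code at `i ≥
  -- i₀` gives a common `Y`, unbounded in `k i`, inside both `X` and `X'`.
  obtain ⟨i, hi, hiS, hiZ⟩ : ∃ i, i₀ ≤ i ∧ i ∈ S X ∧ code i (e i (Y X i)) ∈ Z X := by
    by_contra! H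
    have h1 : Z X ⊆ (fun i => code i (e i (Y X i))) '' Iio i₀ := by
      intro z hz
      obtain ⟨i, hi, rfl⟩ := hZG X hX hz
      exact ⟨i, not_le.1 fun h => H i h hi hz, rfl⟩
    have h2 := ((mk_le_mk_of_subset h1).trans mk_image_le).trans_lt (mk_Iio_lt_of_regular i₀)
    rw [hΘ, (hDn (hZD X hX)).1.2] at h2
    exact h2.false
  obtain ⟨i', hi', heq⟩ := hZG X' hX' (hZ ▸ hiZ)
  obtain ⟨rfl, hv⟩ := hcode _ _ _ _ (he' i' _ (hYD X' i' hi')) (he' i _ (hYD X i hiS)) heq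
  have hYY : Y X' i' = Y X i' := he i' (hYD X' i' hi') (hYD X i' hiS) hv
  obtain ⟨y, hy, hay⟩ := hD i' _ (hYD X i' hiS) a
    (hi₀.trans_le (ord_le_ord.2 (hk.monotone hi)))
  exact ⟨y, ⟨hYX X i' hiS hy, hYX X' i' hi' (hYY ▸ hy)⟩, hay⟩

theorem isSuccLimit_of_mem_cofSet (hκ : ℵ₀ ≤ κ) {i : Iio θ.ord} (hi : i ∈ cofSet θ κ) :
    Order.IsSuccLimit i := by
  have hi' : (i : Ordinal).cof = κ := hi
  have h : Order.IsSuccLimit (i : Ordinal) := by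
    rw [← Ordinal.one_lt_cof_iff, hi']
    exact one_lt_aleph0.trans_le hκ
  refine ⟨fun hmin => ?_, fun b hb => h.isSuccPrelimit b ⟨hb.1, fun c hbc hci => ?_⟩⟩
  · have h0 : (0 : Ordinal) < i := pos_iff_ne_zero.2 h.ne_bot
    exact (hmin (b := ⟨0, h0.trans i.2⟩) h0.le).not_gt h0
  · exact hb.2 (c := ⟨c, hci.trans i.2⟩) hbc hci

/-- The bound on antichains, by induction on the exponent. -/
theorem mk_le_of_mk_le_succIter (hκ : ℵ₀ ≤ κ) (hθ : θ = μ.ord.cof) (hθr : θ.IsRegular)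
    (hθ0 : ℵ₀ < θ) (hθμ : θ < μ) (hk : Order.IsNormal k) (hkμ : IsLUB (range k) μ)
    (hkltμ : ∀ i, k i < μ) (hθk : ∀ i, θ < k i)
    (hA : IsAntichainIn A (upperSubsets μ θ)) {L : Cardinal.{u + 1}}
    (hL1 : lowerDensity μ θ ≤ L) (hL2 : density (stationarySubsets θ κ) ≤ L)
    {a : Ordinal.{u}} (ha : a < θ.ord) (hLa : lift.{u + 1} (succIter μ a) ≤ L)
    {D : Iio θ.ord → Set (Set Ordinal.{u})}
    (hD : ∀ i, ∀ Y ∈ D i, i ∈ cofSet θ κ ∧ ∀ a < (k i).ord, ∃ y ∈ Y, a ≤ y)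
    (hDa : ∀ i, #(D i) ≤ lift.{u + 1} (succIter (k i) a)) {B : Set (Set Ordinal.{u})}
    (hB : B ⊆ A) (hst : ∀ X ∈ B, IsStationary {i | ∃ Y ∈ D i, Y ⊆ X}) : #B ≤ L := by
  induction a using WellFoundedLT.induction generalizing D B with | ind a IH
  have hk0 : ∀ i, ℵ₀ ≤ k i := fun i => (hθ0.trans (hθk i)).le
  have hL0 : ℵ₀ ≤ L := by
    refine le_trans ?_ hLa
    rw [aleph0_le_lift]
    exact (hθ0.trans hθμ).le.trans (le_succIter _ _)
  choose e he he' using fun i => exists_injOn_lt_ord (hDa i)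
  obtain ⟨Dn, hDn, hdense, hcard⟩ := exists_isDenseIn_mk_eq_density (stationarySubsets θ κ)
  choose J g hJ hsmall hg using fun S : Dn =>
    hasSmallDomination hθr hθ0 hθμ hk hkμ hθk ha S (hDn S.2).2
      fun i hi => isSuccLimit_of_mem_cofSet hκ ((hDn S.2).1 hi)
  let D' : (S : Dn) → J S → Iio θ.ord → Set (Set Ordinal.{u}) := fun S j i =>
    {Y ∈ D i | e i Y ≤ g S j i}
  let B' : (S : Dn) → J S → Set (Set Ordinal.{u}) := fun S j =>
    {X ∈ B | IsStationary {i | ∃ Y ∈ D' S j i, Y ⊆ X}}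
  -- Working below a set `S` of the dense family, rather than the selection set of `X`, keeps the
  -- number of domination families at most `L`.
  have hsub : B ⊆ ⋃ S, ⋃ j, B' S j := by
    intro X hX
    classical
    obtain ⟨S, hSD, hSX⟩ := hdense {i | ∃ Y ∈ D i, Y ⊆ X}
      ⟨fun i ⟨Y, hY, _⟩ => (hD i Y hY).1, hst X hX⟩
    let p : Iio θ.ord → Ordinal.{u} := fun i =>
      if h : ∃ Y ∈ D i, Y ⊆ X then e i h.choose else 0
    obtain ⟨j, hj⟩ := hg ⟨S, hSD⟩ p fun i => by
      by_cases h : ∃ Y ∈ D i, Y ⊆ X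
      · simp only [p, dif_pos h]
        exact he' i _ h.choose_spec.1
      · simp only [p, dif_neg h]
        rw [Cardinal.lt_ord, card_zero]
        exact aleph0_pos.trans_le ((hk0 i).trans (le_succIter _ _))
    refine mem_iUnion₂.2 ⟨⟨S, hSD⟩, j, hX, hj.mono ?_⟩
    rintro i ⟨hiS, hi⟩
    have h : ∃ Y ∈ D i, Y ⊆ X := hSX hiS
    simp only [p, dif_pos h] at hi
    exact ⟨h.choose, ⟨h.choose_spec.1, hi⟩, h.choose_spec.2⟩
  refine (mk_le_mk_of_subset hsub).trans (mk_iUnion_le_of_le hL0 (hcard.le.trans hL2) fun S =>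
    mk_iUnion_le_of_le hL0 ((hJ S).trans hLa) fun j => ?_)
  have hinj : ∀ i, InjOn (e i) (D' S j i) := fun i => (he i).mono (sep_subset _ _)
  obtain ⟨b, hb, hsm⟩ | ⟨j', hsm⟩ := hsmall S j
  · exact IH b hb (hb.trans ha)
      ((Cardinal.lift_le.2 (succIter_mono_right hb.le)).trans hLa) (D := D' S j)
      (fun i Y hY => hD i Y hY.1)
      (fun i => mk_le_of_injOn_le (hinj i) (fun w hw => hw.2) (hsm i)
        ((hk0 i).trans (le_succIter _ _)))
      (fun X hX => hB hX.1) fun X hX => hX.2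
  · exact (mk_le_lowerDensity hθ hθr hθ0 hθμ hkμ hkltμ hk.strictMono hk0 hA (D := D' S j)
      (fun i Y hY => (hD i Y hY.1).2)
      (fun i => mk_le_of_injOn_le (hinj i) (fun w hw => hw.2) (hsm i) (hk0 j'))
      (fun X hX => hB hX.1) fun X hX => hX.2).trans hL1

end Antichain

end DensityArithmetic

theorem theorem2p6 (κ θ μ : Cardinal.{u}) (hκ : κ.IsRegular) (hκθ : κ < θ)
    (hθ : θ = μ.ord.cof) (hθμ : θ < μ)
    (k : Iio θ.ord → Cardinal.{u}) (hk : Order.IsNormal k) (hkμ : IsLUB (range k) μ)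
    (hθk : ∀ i, θ < k i)
    (A : Set (Set Ordinal.{u}))
    (hA : DensityArithmetic.IsAntichainIn A (DensityArithmetic.upperSubsets μ θ))
    (γ : Ordinal.{u}) (hγ : γ < θ.ord)
    (hD : ∃ D : DensityArithmetic.cofSet θ κ → Set (Set Ordinal.{u}),
      (∀ i, D i ⊆ DensityArithmetic.upperSubsets (k i) κ ∧
        #(D i) ≤ lift.{u + 1} (DensityArithmetic.succIter (k i) γ)) ∧
      ∀ X ∈ A, IsStationary
        {i : Iio θ.ord | ∃ hi : i ∈ DensityArithmetic.cofSet θ κ, ∃ Y ∈ D ⟨i, hi⟩, Y ⊆ X}) :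
    #A ≤ lift.{u + 1} (DensityArithmetic.succIter μ γ) +
      DensityArithmetic.lowerDensity μ θ +
      DensityArithmetic.density (DensityArithmetic.stationarySubsets θ κ) := by
  obtain ⟨D, hD, hst⟩ := hD
  have hθ0 : ℵ₀ < θ := hκ.aleph0_le.trans_lt hκθ
  have hθr : θ.IsRegular := by
    rw [hθ]
    exact isRegular_cof (isSuccLimit_ord (hθ0.trans hθμ).le)
  have := DensityArithmetic.isRegularCardinalOrder_Iio hθr
  have hkltμ : ∀ i, k i < μ := fun i => by
    obtain ⟨i', h, -⟩ := DensityArithmetic.exists_succ_of_regular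
      (by rw [DensityArithmetic.mk_Iio_ord_card, aleph0_le_lift]; exact hθ0.le) i
    exact (hk.strictMono h).trans_le (hkμ.1 ⟨i', rfl⟩)
  -- The families are extended by the empty set to indices outside `cofSet θ κ`.
  refine DensityArithmetic.mk_le_of_mk_le_succIter hκ.aleph0_le hθ hθr hθ0 hθμ hk hkμ hkltμ hθk hA
    (le_add_self.trans le_self_add) le_add_self hγ (le_self_add.trans le_self_add)
    (D := fun i => {Y | ∃ hi : i ∈ DensityArithmetic.cofSet θ κ, Y ∈ D ⟨i, hi⟩}) ?_ ?_ subset_rfl ?_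
  · rintro i Y ⟨hi, hY⟩
    exact ⟨hi, fun a ha => DensityArithmetic.exists_ge_of_mem_upperSubsets ((hD ⟨i, hi⟩).1 hY) ha⟩
  · intro i
    by_cases hi : i ∈ DensityArithmetic.cofSet θ κ
    · refine (mk_le_mk_of_subset ?_).trans (hD ⟨i, hi⟩).2
      rintro Y ⟨_, hY⟩
      exact hY
    · have : {Y | ∃ hi : i ∈ DensityArithmetic.cofSet θ κ, Y ∈ D ⟨i, hi⟩} = ∅ := by ext; simp [hi]
      rw [this]
      simp
  · intro X hX
    refine (hst X hX).mono ?_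
    rintro i ⟨hi, Y, hY, hYX⟩
    exact ⟨Y, ⟨hi, hY⟩, hYX⟩
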